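/- Let $n,q\ge 2$ be integers, let $H\in(\tfrac12,1)$ and put $H_0=1-\frac{1-H}{q}$. Let $A_{n,q}$ be the set of multi-indices $\alpha=(\alpha_{ij})_{1\le i<j\le n}$ of non-negative integers such that, for each $k=1,\dots,n$, $\sum_{1\le i<j\le n}\alpha_{ij}\mathbf 1_{k\in\{i,j\}}\le q$. Let $\alpha\in A_{n,q}$ and let $x:\mathbb R\to\mathbb R$ belong to $L^1(\mathbb R)\cap L^{1/H}(\mathbb R)$. Then $$\int_{\mathbb R^n}\prod_{k=1}^n|x(\eta_k)|\prod_{1\le i<j\le n}|\eta_i-\eta_j|^{(2H_0-2)\alpha_{ij}}\,d\eta_1\cdots d\eta_n<\infty.$$ -/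

import Mathlib

open MeasureTheory
open scoped ENNReal

/-- The index set of pairs `(i, j)` with `i < j`, for indices in `Fin n`. -/
abbrev IncPair (n : ℕ) : Type := {p : Fin n × Fin n // p.1 < p.2}

/-- The set `A_{n,q}` of multi-indices `α = (α_{ij})_{i < j}` with natural number entries such that,
for each `k`, the sum of the `α_{ij}` over the pairs `i < j` with `k ∈ {i, j}` is at most `q`. -/
def multiIndexSet (n q : ℕ) : Set (IncPair n → ℕ) :=
  {α | ∀ k : Fin n, (∑ p : IncPair n, if k = p.1.1 ∨ k = p.1.2 then α p else 0) ≤ q}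

/-- The parameter `H₀ = 1 - (1 - H) / q`. -/
noncomputable def selfSimH0 (H : ℝ) (q : ℕ) : ℝ := 1 - (1 - H) / (q : ℝ)

/-!
The weights `α_{ij} / q` form a fractional matching of the complete graph, so Finner's extension of
Hölder's inequality, applied to the measures `|x(η)| dη` (finite because `x ∈ L¹`), bounds the
integral by a product of powers of pair integrals `∬ |x(u)| |x(v)| |u - v| ^ (2H - 2) du dv`. These
are finite by Hardy–Littlewood–Sobolev for `x ∈ L^{1/H}`. By symmetry it suffices to integrate over
`{|x(u)| ≤ |x(v)|}`; with `b = |x(v)|` fixed, the integral in `u` is split at distance `b ^ (-1/H)`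
from `v`, using `|x(u)| ≤ b` near `v` and Hölder's inequality far from it. This bounds it by
`C b ^ (1/H - 1)`, and integrating in `v` against `b` leaves `∫ |x| ^ (1/H)`.
-/

section Kernel

open Metric Module
open scoped Pointwise

variable {E : Type*} [NormedAddCommGroup E] [NormedSpace ℝ E] [FiniteDimensional ℝ E]
  [MeasurableSpace E] [BorelSpace E] (μ : Measure E) [μ.IsAddHaarMeasure]

theorem setLIntegral_smul_enorm_rpow {r : ℝ} (hr : 0 < r) (s : Set E) (a : ℝ) :
    ∫⁻ x in r • s, ‖x‖ₑ ^ a ∂μ =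
      ENNReal.ofReal r ^ (a + finrank ℝ E) * ∫⁻ x in s, ‖x‖ₑ ^ a ∂μ := by
  have hr' : ENNReal.ofReal r ≠ 0 := by simpa using hr
  have hmap : μ = ENNReal.ofReal r ^ (finrank ℝ E : ℝ) • μ.map (r • ·) := by
    rw [Measure.map_addHaar_smul μ hr.ne', smul_smul, abs_of_pos (by positivity),
      ENNReal.rpow_natCast, ← ENNReal.ofReal_pow hr.le, ← ENNReal.ofReal_mul (by positivity),
      mul_inv_cancel₀ (by positivity), ENNReal.ofReal_one, one_smul]
  calc ∫⁻ x in r • s, ‖x‖ₑ ^ a ∂μ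
      = ENNReal.ofReal r ^ (finrank ℝ E : ℝ) * ∫⁻ x in r • s, ‖x‖ₑ ^ a ∂μ.map (r • ·) := by
        conv_lhs => rw [hmap]
        rw [Measure.restrict_smul, lintegral_smul_measure, smul_eq_mul]
    _ = ENNReal.ofReal r ^ (finrank ℝ E : ℝ) * ∫⁻ x in s, ‖r • x‖ₑ ^ a ∂μ := by
        have hemb := measurableEmbedding_const_smul₀ (α := E) hr.ne'
        rw [hemb.restrict_map, hemb.lintegral_map, Set.preimage_smul₀ hr.ne',
          inv_smul_smul₀ hr.ne']
    _ = _ := by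
        simp_rw [enorm_smul, Real.enorm_eq_ofReal hr.le,
          ENNReal.mul_rpow_of_ne_top ENNReal.ofReal_ne_top enorm_ne_top]
        rw [lintegral_const_mul' _ _ (ENNReal.rpow_ne_top_of_ne_zero hr' ENNReal.ofReal_ne_top),
          ← mul_assoc, ENNReal.rpow_add _ _ hr' ENNReal.ofReal_ne_top, mul_comm (_ ^ a)]

theorem setLIntegral_unitBall_enorm_rpow_lt_top [Nontrivial E] {a : ℝ} (ha : -finrank ℝ E < a) :
    ∫⁻ x in ball (0 : E) 1, ‖x‖ₑ ^ a ∂μ < ∞ := by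
  have hint : IntegrableOn (fun x : E ↦ ‖x‖ ^ a) (ball 0 1) μ := by
    refine (integrableOn_fun_norm_addHaar μ (f := (· ^ a))).2 ?_
    have hd : ((finrank ℝ E - 1 : ℕ) : ℝ) = finrank ℝ E - 1 := by
      rw [Nat.cast_sub finrank_pos, Nat.cast_one]
    refine ((intervalIntegral.integrableOn_Ioo_rpow_iff (s := finrank ℝ E - 1 + a)
      zero_lt_one).2 (by linarith)).congr_fun (fun y hy ↦ ?_) measurableSet_Ioo
    simp only [smul_eq_mul]
    rw [Real.rpow_add hy.1, ← hd, Real.rpow_natCast]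
  refine (lintegral_congr_ae (ae_restrict_of_ae ?_)).trans_lt hint.hasFiniteIntegral
  filter_upwards [Measure.ae_ne μ (0 : E)] with x hx
  rw [Real.enorm_of_nonneg (by positivity), ← ofReal_norm,
    ENNReal.ofReal_rpow_of_pos (norm_pos_iff.2 hx)]

theorem setLIntegral_compl_unitBall_enorm_rpow_lt_top {a : ℝ} (ha : a < -finrank ℝ E) :
    ∫⁻ x in (ball (0 : E) 1)ᶜ, ‖x‖ₑ ^ a ∂μ < ∞ := by
  have ha0 : a ≤ 0 := ha.le.trans (by simp)
  have hle : ∀ x ∈ (ball (0 : E) 1)ᶜ,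
      ‖x‖ₑ ^ a ≤ ENNReal.ofReal (2⁻¹ ^ a) * ENNReal.ofReal ((1 + ‖x‖) ^ (- -a)) := by
    intro x hx
    have hx1 : 1 ≤ ‖x‖ := by simpa using hx
    rw [← ofReal_norm, ENNReal.ofReal_rpow_of_pos (by linarith), neg_neg,
      ← ENNReal.ofReal_mul (by positivity), ← Real.mul_rpow (by norm_num) (by positivity)]
    exact ENNReal.ofReal_le_ofReal
      (Real.rpow_le_rpow_of_nonpos (by positivity) (by linarith) ha0)
  calc ∫⁻ x in (ball (0 : E) 1)ᶜ, ‖x‖ₑ ^ a ∂μ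
      ≤ ∫⁻ x in (ball (0 : E) 1)ᶜ,
          ENNReal.ofReal (2⁻¹ ^ a) * ENNReal.ofReal ((1 + ‖x‖) ^ (- -a)) ∂μ :=
        setLIntegral_mono' measurableSet_ball.compl hle
    _ ≤ ∫⁻ x, ENNReal.ofReal (2⁻¹ ^ a) * ENNReal.ofReal ((1 + ‖x‖) ^ (- -a)) ∂μ :=
        setLIntegral_le_lintegral _ _
    _ < ∞ := by
        rw [lintegral_const_mul' _ _ ENNReal.ofReal_ne_top]
        exact ENNReal.mul_lt_top ENNReal.ofReal_lt_top (finite_integral_one_add_norm (by linarith))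

variable {H : ℝ} {f g : E → ℝ≥0∞}

theorem setLIntegral_ball_mul_enorm_rpow_le (hf : Measurable f) {b : ℝ≥0∞} (hb : b ≠ ∞)
    {R : ℝ} (hR : 0 < R) (a : ℝ) :
    ∫⁻ x in {x | f x ≤ b} ∩ ball 0 R, f x * ‖x‖ₑ ^ a ∂μ ≤
      b * (ENNReal.ofReal R ^ (a + finrank ℝ E) * ∫⁻ x in ball (0 : E) 1, ‖x‖ₑ ^ a ∂μ) := by
  calc _ ≤ ∫⁻ x in {x | f x ≤ b} ∩ ball 0 R, b * ‖x‖ₑ ^ a ∂μ :=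
        setLIntegral_mono' ((measurableSet_le hf measurable_const).inter measurableSet_ball)
          fun x hx ↦ mul_le_mul_left hx.1 _
    _ ≤ ∫⁻ x in ball 0 R, b * ‖x‖ₑ ^ a ∂μ := lintegral_mono_set Set.inter_subset_right
    _ = _ := by
        rw [lintegral_const_mul' _ _ hb, ← setLIntegral_smul_enorm_rpow μ hR,
          smul_unitBall_of_pos hR]

theorem setLIntegral_compl_ball_mul_enorm_rpow_le (hH0 : 0 < H) (hH1 : H < 1)
    (hf : Measurable f) {R : ℝ} (hR : 0 < R) (a : ℝ) :
    ∫⁻ x in (ball (0 : E) R)ᶜ, f x * ‖x‖ₑ ^ a ∂μ ≤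
      (∫⁻ x, f x ^ H⁻¹ ∂μ) ^ H * (ENNReal.ofReal R ^ (a / (1 - H) + finrank ℝ E) *
        ∫⁻ x in (ball (0 : E) 1)ᶜ, ‖x‖ₑ ^ (a / (1 - H)) ∂μ) ^ (1 - H) := by
  calc _ ≤ (∫⁻ x in (ball (0 : E) R)ᶜ, f x ^ H⁻¹ ∂μ) ^ H *
          (∫⁻ x in (ball (0 : E) R)ᶜ, (‖x‖ₑ ^ a) ^ (1 - H)⁻¹ ∂μ) ^ (1 - H) := by
        simpa using ENNReal.lintegral_mul_le_Lp_mul_Lq _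
          (Real.HolderConjugate.one_sub_inv_inv hH0 hH1).symm hf.aemeasurable
          (measurable_enorm.pow_const a).aemeasurable
    _ ≤ _ := by
        have hscale : R • (ball (0 : E) 1)ᶜ = (ball 0 R)ᶜ := by
          rw [← Set.image_smul, Set.image_compl_eq (MulAction.bijective₀ hR.ne'), Set.image_smul,
            smul_unitBall_of_pos hR]
        rw [← setLIntegral_smul_enorm_rpow μ hR, hscale]
        simp_rw [← ENNReal.rpow_mul, div_eq_mul_inv]
        exact mul_le_mul_left (ENNReal.rpow_le_rpow (setLIntegral_le_lintegral _ _) hH0.le) _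

theorem setLIntegral_le_mul_enorm_rpow_le [Nontrivial E] (hH0 : 0 < H) (hH1 : H < 1)
    (hf : Measurable f) {b : ℝ≥0∞} (hb0 : b ≠ 0) (hb : b ≠ ∞) :
    ∫⁻ x in {x | f x ≤ b}, f x * ‖x‖ₑ ^ ((2 * H - 2) * finrank ℝ E) ∂μ ≤
      ((∫⁻ x in ball (0 : E) 1, ‖x‖ₑ ^ ((2 * H - 2) * finrank ℝ E) ∂μ) +
        (∫⁻ x, f x ^ H⁻¹ ∂μ) ^ H *
          (∫⁻ x in (ball (0 : E) 1)ᶜ, ‖x‖ₑ ^ (-2 * finrank ℝ E : ℝ) ∂μ) ^ (1 - H)) *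
        b ^ (H⁻¹ - 1) := by
  have hd : (finrank ℝ E : ℝ) ≠ 0 := by exact_mod_cast finrank_pos.ne'
  obtain ⟨R, hR, hRb⟩ : ∃ R : ℝ, 0 < R ∧ ENNReal.ofReal R = b ^ (-(H * finrank ℝ E)⁻¹) := by
    have htop : b ^ (-(H * finrank ℝ E)⁻¹) ≠ ∞ := ENNReal.rpow_ne_top_of_ne_zero hb0 hb
    exact ⟨_, ENNReal.toReal_pos (ENNReal.rpow_pos hb0.bot_lt hb).ne' htop,
      ENNReal.ofReal_toReal htop⟩
  have hnear : b * ENNReal.ofReal R ^ ((2 * H - 2) * finrank ℝ E + finrank ℝ E) =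
      b ^ (H⁻¹ - 1) := by
    rw [hRb, ← ENNReal.rpow_mul]
    nth_rw 1 [← ENNReal.rpow_one b, ← ENNReal.rpow_add _ _ hb0 hb]
    congr 1
    field_simp
    ring
  have hexp : (2 * H - 2) * finrank ℝ E / (1 - H) = -2 * finrank ℝ E := by
    rw [div_eq_iff (by linarith)]
    ring
  have hfar : (ENNReal.ofReal R ^ (-2 * finrank ℝ E + finrank ℝ E : ℝ)) ^ (1 - H) =
      b ^ (H⁻¹ - 1) := by
    rw [hRb, ← ENNReal.rpow_mul, ← ENNReal.rpow_mul]
    congr 1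
    field_simp
    ring
  calc ∫⁻ x in {x | f x ≤ b}, f x * ‖x‖ₑ ^ ((2 * H - 2) * finrank ℝ E) ∂μ
      = (∫⁻ x in {x | f x ≤ b} ∩ ball 0 R, f x * ‖x‖ₑ ^ ((2 * H - 2) * finrank ℝ E) ∂μ) +
          ∫⁻ x in {x | f x ≤ b} \ ball 0 R, f x * ‖x‖ₑ ^ ((2 * H - 2) * finrank ℝ E) ∂μ :=
        (lintegral_inter_add_sdiff _ _ measurableSet_ball).symm
    _ ≤ _ := add_le_add (setLIntegral_ball_mul_enorm_rpow_le μ hf hb hR _)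
        ((lintegral_mono_set fun _ hx ↦ hx.2).trans
          (setLIntegral_compl_ball_mul_enorm_rpow_le μ hH0 hH1 hf hR _))
    _ = _ := by
        rw [← mul_assoc, hnear, hexp, ENNReal.mul_rpow_of_nonneg _ _ (by linarith), hfar]
        ring

theorem exists_setLIntegral_le_mul_enorm_sub_rpow_le [Nontrivial E] (hH : 1 / 2 < H)
    (hH1 : H < 1) (hf : Measurable f) (hfH : ∫⁻ x, f x ^ H⁻¹ ∂μ ≠ ∞) :
    ∃ C : ℝ≥0∞, C ≠ ∞ ∧ ∀ (y : E) (b : ℝ≥0∞), b ≠ 0 → b ≠ ∞ →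
      ∫⁻ x in {x | f x ≤ b}, f x * ‖x - y‖ₑ ^ ((2 * H - 2) * finrank ℝ E) ∂μ ≤
        C * b ^ (H⁻¹ - 1) := by
  have hH0 : 0 < H := by linarith
  have hd : (0 : ℝ) < finrank ℝ E := by exact_mod_cast finrank_pos
  refine ⟨_, ENNReal.add_ne_top.2
    ⟨(setLIntegral_unitBall_enorm_rpow_lt_top μ (a := (2 * H - 2) * finrank ℝ E)
        (by nlinarith)).ne,
      ENNReal.mul_ne_top (ENNReal.rpow_ne_top_of_nonneg hH0.le hfH)
        (ENNReal.rpow_ne_top_of_nonneg (sub_nonneg.2 hH1.le)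
          (setLIntegral_compl_unitBall_enorm_rpow_lt_top μ (a := -2 * finrank ℝ E)
            (by linarith)).ne)⟩,
    fun y b hb0 hb ↦ ?_⟩
  rw [← (measurePreserving_add_right μ y).setLIntegral_comp_preimage_emb
    (measurableEmbedding_addRight y), ← lintegral_add_right_eq_self (fun x ↦ f x ^ H⁻¹) y]
  simp only [add_sub_cancel_right]
  exact setLIntegral_le_mul_enorm_rpow_le μ hH0 hH1 (hf.comp (measurable_add_const y)) hb0 hb

theorem setLIntegral_prod_le_mul_enorm_sub_rpow_lt_top [Nontrivial E] (hH : 1 / 2 < H)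
    (hH1 : H < 1) (hf : Measurable f) (hg : Measurable g) (hg_top : ∀ y, g y ≠ ∞)
    (hfH : ∫⁻ x, f x ^ H⁻¹ ∂μ ≠ ∞) (hgH : ∫⁻ x, g x ^ H⁻¹ ∂μ ≠ ∞) :
    ∫⁻ z in {z : E × E | f z.1 ≤ g z.2},
      f z.1 * g z.2 * ‖z.1 - z.2‖ₑ ^ ((2 * H - 2) * finrank ℝ E) ∂μ.prod μ < ∞ := by
  obtain ⟨C, hC_top, hC⟩ := exists_setLIntegral_le_mul_enorm_sub_rpow_le μ hH hH1 hf hfH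
  set K : E → ℝ≥0∞ := fun x ↦ ‖x‖ₑ ^ ((2 * H - 2) * finrank ℝ E)
  have hfiber (y : E) : ∫⁻ x in {x | f x ≤ g y}, f x * g y * K (x - y) ∂μ ≤ C * g y ^ H⁻¹ := by
    rcases eq_or_ne (g y) 0 with h0 | h0
    · simp [h0]
    calc ∫⁻ x in {x | f x ≤ g y}, f x * g y * K (x - y) ∂μ
        = g y * ∫⁻ x in {x | f x ≤ g y}, f x * K (x - y) ∂μ := by
          rw [← lintegral_const_mul' _ _ (hg_top y)]
          simp only [mul_left_comm, mul_assoc]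
      _ ≤ g y * (C * g y ^ (H⁻¹ - 1)) := mul_le_mul_right (hC y _ h0 (hg_top y)) _
      _ = C * g y ^ H⁻¹ := by
          rw [mul_left_comm, ENNReal.rpow_sub _ _ h0 (hg_top y), ENNReal.rpow_one,
            ENNReal.mul_div_cancel h0 (hg_top y)]
  have hmeas : MeasurableSet {z : E × E | f z.1 ≤ g z.2} :=
    measurableSet_le (hf.comp measurable_fst) (hg.comp measurable_snd)
  have hF : Measurable fun z : E × E ↦ f z.1 * g z.2 * K (z.1 - z.2) := by fun_prop
  calc ∫⁻ z in {z : E × E | f z.1 ≤ g z.2}, f z.1 * g z.2 * K (z.1 - z.2) ∂μ.prod μ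
      = ∫⁻ y, ∫⁻ x in {x | f x ≤ g y}, f x * g y * K (x - y) ∂μ ∂μ := by
        rw [← lintegral_indicator hmeas, lintegral_prod_symm' _ (hF.indicator hmeas)]
        refine lintegral_congr fun y ↦ ?_
        rw [← lintegral_indicator (measurableSet_le hf measurable_const)]
        rfl
    _ ≤ ∫⁻ y, C * g y ^ H⁻¹ ∂μ := lintegral_mono hfiber
    _ = C * ∫⁻ y, g y ^ H⁻¹ ∂μ := lintegral_const_mul' _ _ hC_top
    _ < ∞ := ENNReal.mul_lt_top hC_top.lt_top hgH.lt_top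

theorem lintegral_prod_mul_enorm_sub_rpow_lt_top [Nontrivial E] (hH : 1 / 2 < H)
    (hH1 : H < 1) (hf : Measurable f) (hg : Measurable g) (hf_top : ∀ y, f y ≠ ∞)
    (hg_top : ∀ y, g y ≠ ∞)
    (hfH : ∫⁻ x, f x ^ H⁻¹ ∂μ ≠ ∞) (hgH : ∫⁻ x, g x ^ H⁻¹ ∂μ ≠ ∞) :
    ∫⁻ z : E × E, f z.1 * g z.2 * ‖z.1 - z.2‖ₑ ^ ((2 * H - 2) * finrank ℝ E) ∂μ.prod μ < ∞ := by
  set F : E × E → ℝ≥0∞ := fun z ↦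
    f z.1 * g z.2 * ‖z.1 - z.2‖ₑ ^ ((2 * H - 2) * finrank ℝ E)
  have hmeas : MeasurableSet {z : E × E | f z.1 ≤ g z.2} :=
    measurableSet_le (hf.comp measurable_fst) (hg.comp measurable_snd)
  have hswap : ∫⁻ z in {z : E × E | g z.2 ≤ f z.1}, F z ∂μ.prod μ < ∞ := by
    rw [← Measure.measurePreserving_swap.setLIntegral_comp_preimage_emb
      MeasurableEquiv.prodComm.measurableEmbedding]
    refine (lintegral_congr fun z ↦ ?_).trans_lt
      (setLIntegral_prod_le_mul_enorm_sub_rpow_lt_top μ hH hH1 hg hf hf_top hgH hfH)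
    simp only [F, Prod.fst_swap, Prod.snd_swap, enorm_sub_rev z.2, mul_comm (f z.2)]
  calc ∫⁻ z, F z ∂μ.prod μ
      = (∫⁻ z in {z : E × E | f z.1 ≤ g z.2}, F z ∂μ.prod μ) +
          ∫⁻ z in {z : E × E | f z.1 ≤ g z.2}ᶜ, F z ∂μ.prod μ :=
        (lintegral_add_compl _ hmeas).symm
    _ ≤ (∫⁻ z in {z : E × E | f z.1 ≤ g z.2}, F z ∂μ.prod μ) +
          ∫⁻ z in {z : E × E | g z.2 ≤ f z.1}, F z ∂μ.prod μ := by
        gcongr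
        exact fun z hz ↦ (not_le.1 (show ¬f z.1 ≤ g z.2 from hz)).le
    _ < ∞ := ENNReal.add_lt_top.2
        ⟨setLIntegral_prod_le_mul_enorm_sub_rpow_lt_top μ hH hH1 hf hg hg_top hfH hgH, hswap⟩

end Kernel

/-- The weights `w` form a fractional matching of the loopless multigraph on `V` in which the edge
`e : ι` joins `s e` to `t e`: they are nonnegative and at every vertex they sum to at most `1`. The
order of the two ends of an edge is irrelevant. -/
structure IsFractionalMatching {V ι : Type*} [DecidableEq V] [Fintype ι] (s t : ι → V)
    (w : ι → ℝ) : Prop where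
  ne : ∀ e, s e ≠ t e
  nonneg : ∀ e, 0 ≤ w e
  sum_le_one : ∀ k, ∑ e with k ∈ ({s e, t e} : Finset V), w e ≤ 1

section Finner

theorem lintegral_prod_rpow_le_of_sum_le_one {X ι : Type*} [MeasurableSpace X] (ν : Measure X)
    {I : Finset ι} {f : ι → X → ℝ≥0∞} (hf : ∀ i ∈ I, AEMeasurable (f i) ν) {w : ι → ℝ}
    (hw : ∀ i ∈ I, 0 ≤ w i) (hI : ∑ i ∈ I, w i ≤ 1) :
    ∫⁻ y, ∏ i ∈ I, f i y ^ w i ∂ν ≤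
      ν Set.univ ^ (1 - ∑ i ∈ I, w i) * ∏ i ∈ I, (∫⁻ y, f i y ∂ν) ^ w i := by
  simpa using ENNReal.lintegral_mul_prod_norm_pow_le I (g := 1) aemeasurable_const hf
    (1 - ∑ i ∈ I, w i) (sub_add_cancel _ _) (sub_nonneg.2 hI) hw

variable {δ : Type*} [DecidableEq δ] {X : δ → Type*} [∀ k, MeasurableSpace (X k)]
  {ν : ∀ k, Measure (X k)} [∀ k, SigmaFinite (ν k)]

theorem lmarginal_update_of_dependsOn {g : (∀ k, X k) → ℝ≥0∞} (hg : Measurable g) {S : Finset δ}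
    (hS : DependsOn g S) {T : Finset δ} {k : δ} (hkT : k ∉ T) (hkS : k ∉ S) (x : ∀ k, X k)
    (y : X k) : lmarginal ν T g (Function.update x k y) = lmarginal ν T g x := by
  rw [lmarginal_update_of_notMem hg hkT]
  congr 1
  ext z
  exact hS fun j hj ↦ Function.update_of_ne (ne_of_mem_of_not_mem hj hkS) _ _

variable {ι : Type*} [Fintype ι] {S : ι → Finset δ} {w : ι → ℝ} {g : ι → (∀ k, X k) → ℝ≥0∞}

theorem lintegral_prod_lmarginal_update_rpow_le (hw : ∀ i, 0 ≤ w i) (hg : ∀ i, Measurable (g i))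
    (hdep : ∀ i, DependsOn (g i) (S i)) {T : Finset δ} {k : δ} (hkT : k ∉ T)
    (hk : ∑ i with k ∈ S i, w i ≤ 1) (x : ∀ k, X k) :
    ∫⁻ y, ∏ i, lmarginal ν (T ∩ S i) (g i) (Function.update x k y) ^ w i ∂ν k ≤
      ν k Set.univ ^ (1 - ∑ i with k ∈ S i, w i) *
        ∏ i, lmarginal ν (insert k T ∩ S i) (g i) x ^ w i := by
  set h : ι → X k → ℝ≥0∞ := fun i y ↦ lmarginal ν (T ∩ S i) (g i) (Function.update x k y)
  have hmeas (i : ι) : Measurable (h i) := ((hg i).lmarginal ν).comp (measurable_update x)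
  have hkTS (i : ι) : k ∉ T ∩ S i := fun hmem ↦ hkT (Finset.mem_inter.1 hmem).1
  have hmem : ∀ i, k ∈ S i → ∫⁻ y, h i y ∂ν k = lmarginal ν (insert k T ∩ S i) (g i) x :=
    fun i hi ↦ by rw [Finset.insert_inter_of_mem hi, lmarginal_insert _ (hg i) (hkTS i)]
  have hnotMem : ∀ i, k ∉ S i → ∀ y, h i y = lmarginal ν (insert k T ∩ S i) (g i) x :=
    fun i hi y ↦ by
      rw [Finset.insert_inter_of_notMem hi]
      exact lmarginal_update_of_dependsOn (hg i) (hdep i) (hkTS i) hi x y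
  calc ∫⁻ y, ∏ i, h i y ^ w i ∂ν k
      = ∫⁻ y, (∏ i with k ∈ S i, h i y ^ w i) *
          ∏ i with k ∉ S i, lmarginal ν (insert k T ∩ S i) (g i) x ^ w i ∂ν k := by
        refine lintegral_congr fun y ↦ ?_
        rw [← Finset.prod_filter_mul_prod_filter_not Finset.univ (fun i ↦ k ∈ S i)]
        congr 1
        exact Finset.prod_congr rfl fun i hi ↦ by rw [hnotMem i (Finset.mem_filter.1 hi).2]
    _ = (∫⁻ y, ∏ i with k ∈ S i, h i y ^ w i ∂ν k) *
          ∏ i with k ∉ S i, lmarginal ν (insert k T ∩ S i) (g i) x ^ w i :=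
        lintegral_mul_const _ (Finset.measurable_fun_prod _ fun i _ ↦ (hmeas i).pow_const _)
    _ ≤ (ν k Set.univ ^ (1 - ∑ i with k ∈ S i, w i) *
          ∏ i with k ∈ S i, (∫⁻ y, h i y ∂ν k) ^ w i) *
            ∏ i with k ∉ S i, lmarginal ν (insert k T ∩ S i) (g i) x ^ w i :=
        mul_le_mul_left (lintegral_prod_rpow_le_of_sum_le_one (ν k)
          (fun i _ ↦ (hmeas i).aemeasurable) (fun i _ ↦ hw i) hk) _
    _ = _ := by
        rw [mul_assoc, ← Finset.prod_filter_mul_prod_filter_not Finset.univ (fun i ↦ k ∈ S i)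
          (fun i ↦ lmarginal ν (insert k T ∩ S i) (g i) x ^ w i)]
        congr 2
        exact Finset.prod_congr rfl fun i hi ↦ by rw [hmem i (Finset.mem_filter.1 hi).2]

theorem lmarginal_prod_rpow_le (hw : ∀ i, 0 ≤ w i) (hg : ∀ i, Measurable (g i))
    (hdep : ∀ i, DependsOn (g i) (S i)) {T : Finset δ} (hT : ∀ k ∈ T, ∑ i with k ∈ S i, w i ≤ 1)
    (x : ∀ k, X k) :
    lmarginal ν T (fun y ↦ ∏ i, g i y ^ w i) x ≤
      (∏ k ∈ T, ν k Set.univ ^ (1 - ∑ i with k ∈ S i, w i)) *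
        ∏ i, lmarginal ν (T ∩ S i) (g i) x ^ w i := by
  induction T using Finset.induction_on generalizing x with
  | empty => simp
  | insert k T hkT ih =>
    have hmeas : Measurable fun y ↦ ∏ i, g i y ^ w i :=
      Finset.measurable_fun_prod _ fun i _ ↦ (hg i).pow_const _
    set A := ∏ j ∈ T, ν j Set.univ ^ (1 - ∑ i with j ∈ S i, w i)
    calc lmarginal ν (insert k T) (fun y ↦ ∏ i, g i y ^ w i) x
        = ∫⁻ y, lmarginal ν T (fun y ↦ ∏ i, g i y ^ w i) (Function.update x k y) ∂ν k :=
          lmarginal_insert _ hmeas hkT x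
      _ ≤ ∫⁻ y, A * ∏ i, lmarginal ν (T ∩ S i) (g i) (Function.update x k y) ^ w i ∂ν k :=
          lintegral_mono fun y ↦ ih (fun j hj ↦ hT j (Finset.mem_insert_of_mem hj)) _
      _ = A * ∫⁻ y, ∏ i, lmarginal ν (T ∩ S i) (g i) (Function.update x k y) ^ w i ∂ν k :=
          lintegral_const_mul _ (Finset.measurable_fun_prod _ fun i _ ↦
            (((hg i).lmarginal ν).comp (measurable_update x)).pow_const _)
      _ ≤ A * (ν k Set.univ ^ (1 - ∑ i with k ∈ S i, w i) *
            ∏ i, lmarginal ν (insert k T ∩ S i) (g i) x ^ w i) :=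
          mul_le_mul_right (lintegral_prod_lmarginal_update_rpow_le hw hg hdep hkT
            (hT k (Finset.mem_insert_self k T)) x) _
      _ = _ := by rw [Finset.prod_insert hkT, ← mul_assoc, mul_comm A]

theorem lmarginal_pair {a b : δ} (hab : a ≠ b) {K : X a × X b → ℝ≥0∞} (hK : Measurable K)
    (x : ∀ k, X k) :
    lmarginal ν {a, b} (fun η ↦ K (η a, η b)) x = ∫⁻ z, K z ∂(ν a).prod (ν b) := by
  have hKab : Measurable fun η : ∀ k, X k ↦ K (η a, η b) := by fun_prop
  rw [lmarginal_insert _ hKab (by simpa using hab), lintegral_prod _ hK.aemeasurable]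
  simp only [lmarginal_singleton, Function.update_self, Function.update_of_ne hab]

theorem IsFractionalMatching.lintegral_pi_prod_rpow_le [Fintype δ] {s t : ι → δ}
    (hst : IsFractionalMatching s t w) {K : ∀ e, X (s e) × X (t e) → ℝ≥0∞}
    (hK : ∀ e, Measurable (K e)) :
    ∫⁻ η, ∏ e, K e (η (s e), η (t e)) ^ w e ∂Measure.pi ν ≤
      (∏ k, ν k Set.univ ^ (1 - ∑ e with k ∈ ({s e, t e} : Finset δ), w e)) *
        ∏ e, (∫⁻ z, K e z ∂(ν (s e)).prod (ν (t e))) ^ w e := by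
  rcases isEmpty_or_nonempty (∀ k, X k) with _ | ⟨⟨x⟩⟩
  · simp [lintegral_of_isEmpty]
  have hmeas (e : ι) : Measurable fun η : ∀ k, X k ↦ K e (η (s e), η (t e)) :=
    (hK e).comp (by fun_prop)
  have hdep (e : ι) : DependsOn (fun η : ∀ k, X k ↦ K e (η (s e), η (t e)))
      (({s e, t e} : Finset δ) : Set δ) := fun η η' h ↦ by
    simp only [h (s e) (by simp), h (t e) (by simp)]
  simpa only [lintegral_eq_lmarginal_univ x, Finset.univ_inter,
    lmarginal_pair (hst.ne _) (hK _)] using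
    lmarginal_prod_rpow_le (ν := ν) hst.nonneg hmeas hdep (T := Finset.univ)
      (fun k _ ↦ hst.sum_le_one k) x

end Finner

section WithDensity

variable {δ : Type*} {X : δ → Type*} [∀ k, MeasurableSpace (X k)] {ν : ∀ k, Measure (X k)}
  [∀ k, SigmaFinite (ν k)] {f : ∀ k, X k → ℝ≥0∞} [∀ k, SigmaFinite ((ν k).withDensity (f k))]
  {F : (∀ k, X k) → ℝ≥0∞}

theorem lmarginal_withDensity [DecidableEq δ] (hf : ∀ k, Measurable (f k)) (hF : Measurable F)
    (T : Finset δ) :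
    lmarginal (fun k ↦ (ν k).withDensity (f k)) T F =
      lmarginal ν T fun η ↦ (∏ k ∈ T, f k (η k)) * F η := by
  induction T using Finset.induction_on generalizing F with
  | empty => simp
  | insert k T hkT ih =>
    have hprod : Measurable fun η : ∀ k, X k ↦ (∏ k ∈ insert k T, f k (η k)) * F η :=
      (Finset.measurable_fun_prod _ fun k _ ↦ (hf k).comp (measurable_pi_apply k)).mul hF
    have hupd (η : ∀ k, X k) : Measurable fun y ↦ F (Function.update η k y) :=
      hF.comp (measurable_update η)
    have hinner : Measurable fun η : ∀ k, X k ↦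
        ∫⁻ y, F (Function.update η k y) ∂(ν k).withDensity (f k) := by
      simpa only [lmarginal_singleton] using
        hF.lmarginal (fun k ↦ (ν k).withDensity (f k)) (s := {k})
    rw [lmarginal_insert' _ hF hkT, lmarginal_insert' _ hprod hkT, ih hinner]
    congr 1
    ext η
    rw [lintegral_withDensity_eq_lintegral_mul _ (hf k) (hupd η),
      ← lintegral_const_mul _ ((hf k).mul (hupd η))]
    refine lintegral_congr fun y ↦ ?_
    have hcongr : ∏ j ∈ T, f j (Function.update η k y j) = ∏ j ∈ T, f j (η j) :=
      Finset.prod_congr rfl fun j hj ↦ by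
        rw [Function.update_of_ne (ne_of_mem_of_not_mem hj hkT)]
    rw [Finset.prod_insert hkT, hcongr, Function.update_self, Pi.mul_apply]
    ring

theorem lintegral_pi_withDensity [Fintype δ] (hf : ∀ k, Measurable (f k)) (hF : Measurable F) :
    ∫⁻ η, F η ∂Measure.pi (fun k ↦ (ν k).withDensity (f k)) =
      ∫⁻ η, (∏ k, f k (η k)) * F η ∂Measure.pi ν := by
  classical
  rcases isEmpty_or_nonempty (∀ k, X k) with _ | ⟨⟨x⟩⟩
  · simp only [lintegral_of_isEmpty]
  rw [lintegral_eq_lmarginal_univ x, lintegral_eq_lmarginal_univ x, lmarginal_withDensity hf hF]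

end WithDensity

section FractionalMatching

open Module

variable {V ι E : Type*} [Fintype V] [DecidableEq V] [Fintype ι] [NormedAddCommGroup E]
  [NormedSpace ℝ E] [FiniteDimensional ℝ E] [Nontrivial E] [MeasurableSpace E] [BorelSpace E]
  (μ : Measure E) [μ.IsAddHaarMeasure] {H : ℝ} {s t : ι → V} {w : ι → ℝ}

theorem IsFractionalMatching.lintegral_pi_mul_prod_enorm_sub_rpow_lt_top
    (hst : IsFractionalMatching s t w) (hH : 1 / 2 < H) (hH1 : H < 1) {f : V → E → ℝ≥0∞}
    (hf : ∀ k, Measurable (f k)) (hf_top : ∀ k y, f k y ≠ ∞)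
    (hf1 : ∀ k, ∫⁻ y, f k y ∂μ ≠ ∞) (hfH : ∀ k, ∫⁻ y, f k y ^ H⁻¹ ∂μ ≠ ∞) :
    ∫⁻ η : V → E, (∏ k, f k (η k)) *
      ∏ e, ‖η (s e) - η (t e)‖ₑ ^ ((2 * H - 2) * finrank ℝ E * w e)
        ∂Measure.pi (fun _ ↦ μ) < ∞ := by
  set ν : V → Measure E := fun k ↦ μ.withDensity (f k) with hν
  have (k : V) : IsFiniteMeasure (ν k) := isFiniteMeasure_withDensity (hf1 k)
  set K : E × E → ℝ≥0∞ := fun z ↦ ‖z.1 - z.2‖ₑ ^ ((2 * H - 2) * finrank ℝ E) with hKdef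
  have hK : Measurable K := by fun_prop
  have hpair (e : ι) : ∫⁻ z, K z ∂(ν (s e)).prod (ν (t e)) ≠ ∞ := by
    have hff : Measurable fun z : E × E ↦ f (s e) z.1 * f (t e) z.2 := by fun_prop
    rw [hν, prod_withDensity (hf _) (hf _), lintegral_withDensity_eq_lintegral_mul _ hff hK]
    exact (lintegral_prod_mul_enorm_sub_rpow_lt_top μ hH hH1 (hf _) (hf _) (hf_top _) (hf_top _)
      (hfH _) (hfH _)).ne
  calc _ = ∫⁻ η, ∏ e, K (η (s e), η (t e)) ^ w e ∂Measure.pi ν := by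
        rw [lintegral_pi_withDensity hf (by fun_prop)]
        simp only [hKdef, ENNReal.rpow_mul]
    _ ≤ _ := hst.lintegral_pi_prod_rpow_le fun _ ↦ hK
    _ < ∞ := ENNReal.mul_lt_top
        (ENNReal.prod_lt_top fun k _ ↦
          ENNReal.rpow_lt_top_of_nonneg (sub_nonneg.2 (hst.sum_le_one k)) (measure_ne_top _ _))
        (ENNReal.prod_lt_top fun e _ ↦ ENNReal.rpow_lt_top_of_nonneg (hst.nonneg e) (hpair e))

theorem lemma7p1_general {F : Type*} [NormedAddCommGroup F] (hH : 1 / 2 < H) (hH1 : H < 1)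
    (hst : IsFractionalMatching s t w) {x : V → E → F} (hx1 : ∀ k, MemLp (x k) 1 μ)
    (hxH : ∀ k, MemLp (x k) (ENNReal.ofReal (1 / H)) μ) :
    ∫⁻ η : V → E, (∏ k, ‖x k (η k)‖ₑ) *
      ∏ e, ‖η (s e) - η (t e)‖ₑ ^ ((2 * H - 2) * finrank ℝ E * w e)
        ∂Measure.pi (fun _ ↦ μ) < ∞ := by
  have hH0 : 0 < H⁻¹ := inv_pos.2 (by linarith)
  choose x' hx' hxx' using fun k ↦ (hx1 k).aestronglyMeasurable
  have hae : ∀ᵐ η ∂Measure.pi fun _ : V ↦ μ, ∀ k, x k (η k) = x' k (η k) :=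
    ae_all_iff.2 fun k ↦ (Measure.quasiMeasurePreserving_eval (fun _ ↦ μ) k).ae (hxx' k)
  have hx'1 (k : V) : ∫⁻ y, ‖x' k y‖ₑ ∂μ ≠ ∞ := by
    rw [← eLpNorm_one_eq_lintegral_enorm]
    exact ((memLp_congr_ae (hxx' k)).1 (hx1 k)).eLpNorm_ne_top
  have hx'H (k : V) : ∫⁻ y, ‖x' k y‖ₑ ^ H⁻¹ ∂μ ≠ ∞ := by
    simpa [ENNReal.toReal_ofReal hH0.le] using (lintegral_rpow_enorm_lt_top_of_eLpNorm_lt_top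
      (ENNReal.ofReal_pos.2 (one_div H ▸ hH0)).ne' ENNReal.ofReal_ne_top
      ((memLp_congr_ae (hxx' k)).1 (hxH k)).eLpNorm_lt_top).ne
  refine (lintegral_congr_ae (hae.mono fun η hη ↦ ?_)).trans_lt
    (hst.lintegral_pi_mul_prod_enorm_sub_rpow_lt_top μ hH hH1 (fun k ↦ (hx' k).enorm)
      (fun _ _ ↦ enorm_ne_top) hx'1 hx'H)
  simp only [hη]

end FractionalMatching

theorem isFractionalMatching_of_mem_multiIndexSet {n q : ℕ} {α : IncPair n → ℕ}
    (hα : α ∈ multiIndexSet n q) :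
    IsFractionalMatching (fun p : IncPair n ↦ p.1.1) (fun p ↦ p.1.2)
      (fun p ↦ (α p : ℝ) / q) where
  ne p := p.2.ne
  nonneg p := by positivity
  sum_le_one k := by
    have hdeg : ∑ p : IncPair n with k = p.1.1 ∨ k = p.1.2, α p ≤ q := by
      simpa only [Finset.sum_filter] using hα k
    simp only [Finset.mem_insert, Finset.mem_singleton]
    rw [← Finset.sum_div]
    exact div_le_one_of_le₀ (by exact_mod_cast hdeg) q.cast_nonneg

theorem two_mul_selfSimH0_sub_two_mul (H a : ℝ) (q : ℕ) :
    (2 * selfSimH0 H q - 2) * a = (2 * H - 2) * (a / q) := by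
  rw [selfSimH0]
  ring

theorem lemma7p1 (n q : ℕ) (hn : 2 ≤ n) (hq : 2 ≤ q) (H : ℝ) (hH : 1 / 2 < H) (hH' : H < 1)
    (α : IncPair n → ℕ) (hα : α ∈ multiIndexSet n q) (x : ℝ → ℝ)
    (hx1 : MemLp x 1 (volume : Measure ℝ))
    (hxH : MemLp x (ENNReal.ofReal (1 / H)) (volume : Measure ℝ)) :
    ∫⁻ η : Fin n → ℝ, (∏ k : Fin n, ‖x (η k)‖ₑ) *
      ∏ p : IncPair n, ‖η p.1.1 - η p.1.2‖ₑ ^ ((2 * selfSimH0 H q - 2) * (α p : ℝ)) < ∞ := by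
  simpa [two_mul_selfSimH0_sub_two_mul, volume_pi] using
    lemma7p1_general volume hH hH' (isFractionalMatching_of_mem_multiIndexSet hα)
      (fun _ ↦ hx1) (fun _ ↦ hxH)
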